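/- Let $A$ be a finite set. A *profinite monoid* is a compact Hausdorff topological monoid in which any two distinct points are separated by a continuous homomorphism into a finite discrete monoid. Consider the unary signature with one unary operation symbol for each $a\in A$ and a single nullary symbol $1$; an algebra $U$ of this signature has operations $a_U:U\to U$ ($a\in A$) and a constant $1^U\in U$. A *profinite algebra* is a compact Hausdorff algebra with continuous operations in which any two distinct points are separated by a continuous homomorphism into a finite discrete algebra of the same signature. Let $\mathbb{PM}_A$ be the category whose objects are the maps $\gamma:A\to M$, with $M$ a profinite monoid, such that the closed submonoid of $M$ generated by $\gamma(A)$ is $M$; a morphism from $\gamma:A\to M$ to $\beta:A\to N$ is a continuous monoid homomorphism $\varphi:M\to N$ with $\varphi\circ\gamma=\beta$. Let $\mathbb{PUA}_A^1$ be the category whose objects are the profinite algebras of the above signature without proper closed subalgebras, and whose morphisms are the continuous homomorphisms (these are automatically surjective). Let $\Psi:\mathbb{PM}_A\to\mathbb{PUA}_A^1$ be the functor that sends $\gamma:A\to M$ to the algebra with underlying space $M$, operations $a\cdot m=\gamma(a)m$ and constant $1\in M$, and that sends a morphism $\varphi$ to the same map $\varphi$. For $U$ in $\mathbb{PUA}_A^1$,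 let $\mathcal C(U)$ be the monoid, under composition, of all continuous maps $U\to U$ with the compact-open topology, let $\mathcal M_U$ be its submonoid generated by the maps $a_U$ ($a\in A$), and let $\mu(U)$ be the closure of $\mathcal M_U$ in $\mathcal C(U)$; it is a profinite monoid. Let $\Gamma:\mathbb{PUA}_A^1\to\mathbb{PM}_A$ be the functor that sends $U$ to the map $A\to\mu(U)$, $a\mapsto a_U$, and that sends a morphism $\varphi:U\to V$ to the map $\mu(U)\to\mu(V)$ taking $f$ to the unique $g\in\mu(V)$ with $g\circ\varphi=\varphi\circ f$. Then $\Psi$ is left adjoint to $\Gamma$. -/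

import Mathlib

universe u v

open CategoryTheory

/-! ### Profinite monoids -/

/-- A topological monoid is profinite if it is compact (Hausdorff) and residually finite: distinct
points are separated by a continuous homomorphism into a finite (discrete) monoid. -/
class IsProfiniteMonoid (M : Type u) [Monoid M] [TopologicalSpace M] : Prop extends
    ContinuousMul M, CompactSpace M, T2Space M where
  residually_finite : ∀ s t : M, s ≠ t →
    ∃ (F : Type u) (_ : Monoid F) (_ : Finite F) (_ : TopologicalSpace F) (_ : DiscreteTopology F)
      (h : M →ₜ* F), h s ≠ h t

/-- The category of `A`-generated profinite monoids: an object is a profinite monoid `M` with a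
map `gen : A → M` such that the closed submonoid generated by the image of `gen` is `M`. -/
structure PM (A : Type v) where
  carrier : Type u
  [monoid : Monoid carrier]
  [top : TopologicalSpace carrier]
  [profinite : IsProfiniteMonoid carrier]
  gen : A → carrier
  generates : (Submonoid.closure (Set.range gen)).topologicalClosure = ⊤

attribute [instance] PM.monoid PM.top PM.profinite

/-- Morphisms of `A`-generated profinite monoids: continuous monoid homomorphisms that commute
with the maps from `A`. -/
@[ext]
structure PM.Hom {A : Type v} (X Y : PM.{u} A) where
  map : X.carrier →ₜ* Y.carrier
  map_gen : ∀ a, map (X.gen a) = Y.gen a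

instance (A : Type v) : Category (PM.{u} A) where
  Hom X Y := PM.Hom X Y
  id X := ⟨ContinuousMonoidHom.id X.carrier, fun _ => rfl⟩
  comp f g := ⟨g.map.comp f.map, fun a =>
    (congrArg g.map (f.map_gen a)).trans (g.map_gen a)⟩

/-! ### Profinite unary algebras -/

/-- An algebra for the signature with `A` as set of unary operation symbols and a single nullary
operation symbol. -/
class UnaryAlg (A : Type v) (U : Type u) where
  /-- The unary operation attached to the symbol `a`. -/
  op : A → U → U
  /-- The value of the nullary operation symbol. -/
  pt : U

/-- Homomorphisms of such algebras. -/
structure UnaryAlg.IsHom (A : Type v) {U V : Type*} [UnaryAlg A U] [UnaryAlg A V]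
    (h : U → V) : Prop where
  map_op : ∀ (a : A) (x : U), h (op a x) = op a (h x)
  map_pt : h (pt A) = pt A

/-- A topological algebra is profinite if it is compact (Hausdorff) and residually finite. -/
class IsProfiniteUnaryAlg (A : Type v) (U : Type u) [UnaryAlg A U] [TopologicalSpace U] : Prop
    extends CompactSpace U, T2Space U where
  continuous_op : ∀ a : A, Continuous (UnaryAlg.op a : U → U)
  residually_finite : ∀ s t : U, s ≠ t →
    ∃ (F : Type u) (_ : UnaryAlg A F) (_ : Finite F) (_ : TopologicalSpace F)
      (_ : DiscreteTopology F) (h : U → F), Continuous h ∧ UnaryAlg.IsHom A h ∧ h s ≠ h t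

/-- The category of profinite unary algebras without proper closed subalgebras. -/
structure PUA (A : Type v) where
  carrier : Type u
  [alg : UnaryAlg A carrier]
  [top : TopologicalSpace carrier]
  [profinite : IsProfiniteUnaryAlg A carrier]
  no_proper : ∀ C : Set carrier, IsClosed C → UnaryAlg.pt A ∈ C →
    (∀ (a : A), ∀ x ∈ C, UnaryAlg.op a x ∈ C) → C = Set.univ

attribute [instance] PUA.alg PUA.top PUA.profinite

instance {A : Type v} (U : PUA.{u} A) : CompactSpace U.carrier := U.profinite.toCompactSpace
instance {A : Type v} (U : PUA.{u} A) : T2Space U.carrier := U.profinite.toT2Space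

/-- Morphisms of algebras: continuous homomorphisms. -/
@[ext]
structure PUA.Hom {A : Type v} (U V : PUA.{u} A) where
  map : C(U.carrier, V.carrier)
  isHom : UnaryAlg.IsHom A map

instance (A : Type v) : Category (PUA.{u} A) where
  Hom U V := PUA.Hom U V
  id U := ⟨ContinuousMap.id U.carrier, ⟨fun _ _ => rfl, rfl⟩⟩
  comp f g := ⟨g.map.comp f.map,
    ⟨fun a x => (congrArg g.map (f.isHom.map_op a x)).trans (g.isHom.map_op a _),
      (congrArg g.map f.isHom.map_pt).trans g.isHom.map_pt⟩⟩

/-- Morphisms between algebras without proper closed subalgebras are onto. -/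
theorem PUA.Hom.surjective {A : Type v} {U V : PUA.{u} A} (f : PUA.Hom U V) :
    Function.Surjective f.map := by
  rw [← Set.range_eq_univ]
  refine V.no_proper _ (isCompact_range f.map.continuous).isClosed ⟨_, f.isHom.map_pt⟩ ?_
  rintro a _ ⟨x, rfl⟩
  exact ⟨_, f.isHom.map_op a x⟩

/-! ### The functor `Ψ`: a monoid acting on itself by left multiplication -/

/-- The algebra on `M` with operations `x ↦ γ a * x` and constant `1`. -/
abbrev kappa {A : Type v} {M : Type u} [Monoid M] (γ : A → M) : UnaryAlg A M where
  op a x := γ a * x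
  pt := 1

theorem kappa_isHom {A : Type v} {M N : Type*} [Monoid M] [Monoid N] (γ : A → M) (δ : A → N)
    (h : M →* N) (hγ : ∀ a, h (γ a) = δ a) :
    letI := kappa γ
    letI := kappa δ
    UnaryAlg.IsHom A h := by
  let := kappa γ
  let := kappa δ
  exact ⟨fun a x => (h.map_mul _ _).trans (congrArg (· * h x) (hγ a)), h.map_one⟩

theorem kappa_profinite {A : Type v} {M : Type u} [Monoid M] [TopologicalSpace M]
    [IsProfiniteMonoid M] (γ : A → M) :
    letI := kappa γ
    IsProfiniteUnaryAlg A M := by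
  let := kappa γ
  refine { continuous_op := fun a => continuous_const.mul continuous_id, residually_finite := ?_ }
  intro s t hst
  obtain ⟨F, _, hF, _, _, h, hh⟩ := IsProfiniteMonoid.residually_finite s t hst
  exact ⟨F, kappa (fun a => h (γ a)), hF, _, ‹_›, h, h.continuous_toFun,
    kappa_isHom γ _ h.toMonoidHom (fun _ => rfl), hh⟩

theorem kappa_no_proper {A : Type v} {M : Type u} [Monoid M] [TopologicalSpace M]
    [ContinuousMul M] (γ : A → M)
    (hγ : (Submonoid.closure (Set.range γ)).topologicalClosure = ⊤)
    (C : Set M) (hC : IsClosed C) (h1 : (1 : M) ∈ C) (hop : ∀ a, ∀ x ∈ C, γ a * x ∈ C) :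
    C = Set.univ := by
  have h : (Submonoid.closure (Set.range γ) : Set M) ⊆ C := by
    intro x hx
    induction hx using Submonoid.closure_induction_left with
    | one => exact h1
    | mul_left x hx y _ ih =>
      obtain ⟨a, rfl⟩ := hx
      exact hop a y ih
  have h2 := closure_minimal h hC
  rw [← Submonoid.coe_topologicalClosure, hγ] at h2
  exact Set.eq_univ_of_univ_subset h2

/-- The functor `Ψ`, sending `γ : A → M` to the algebra `M` on which `a` acts by left
multiplication by `γ a`, with constant `1`, and a morphism to itself. -/
def Psi (A : Type v) : PM.{u} A ⥤ PUA.{u} A where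
  obj X :=
    { carrier := X.carrier
      alg := kappa X.gen
      top := X.top
      profinite := kappa_profinite X.gen
      no_proper := kappa_no_proper X.gen X.generates }
  map {X Y} f := ⟨f.map.toContinuousMap, kappa_isHom X.gen Y.gen f.map.toMonoidHom f.map_gen⟩

/-! ### The monoid of continuous transformations -/

/-- The set of continuous transformations of a space `U`. (A type synonym, so that its
multiplication is always composition.) -/
def ContTrans (U : Type u) [TopologicalSpace U] : Type u := C(U, U)

namespace ContTrans

variable {U : Type u} [TopologicalSpace U]

instance : FunLike (ContTrans U) U U := inferInstanceAs (FunLike C(U, U) U U)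

instance : ContinuousMapClass (ContTrans U) U U :=
  inferInstanceAs (ContinuousMapClass C(U, U) U U)

@[ext] theorem ext {f g : ContTrans U} (h : ∀ x, f x = g x) : f = g := DFunLike.ext f g h

/-- The product `f * g` is the composition `x ↦ f (g x)`. -/
instance : Monoid (ContTrans U) where
  mul f g := ContinuousMap.comp f g
  one := ContinuousMap.id U
  mul_assoc _ _ _ := rfl
  one_mul _ := rfl
  mul_one _ := rfl

/-- The compact-open topology. -/
instance : TopologicalSpace (ContTrans U) := ContinuousMap.compactOpen

@[simp] theorem mul_apply (f g : ContTrans U) (x : U) : (f * g) x = f (g x) := rfl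

@[simp] theorem one_apply (x : U) : (1 : ContTrans U) x = x := rfl

instance [LocallyCompactSpace U] : ContinuousMul (ContTrans U) where
  continuous_mul := ContinuousMap.continuous_comp'.comp continuous_swap

instance [T2Space U] : T2Space (ContTrans U) := inferInstanceAs (T2Space C(U, U))

theorem continuous_apply (x : U) : Continuous fun f : ContTrans U => f x :=
  ContinuousEvalConst.continuous_eval_const (F := C(U, U)) x

end ContTrans

/-! ### The profinite monoid `μ(U)` -/

section Mu

variable (A : Type v) (U : Type u) [UnaryAlg A U] [TopologicalSpace U] [IsProfiniteUnaryAlg A U]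

/-- The transformation of `U` given by the operation symbol `a`. -/
def opTrans {A : Type v} (a : A) (U : Type u) [UnaryAlg A U] [TopologicalSpace U]
    [IsProfiniteUnaryAlg A U] : ContTrans U :=
  (⟨UnaryAlg.op a, IsProfiniteUnaryAlg.continuous_op a⟩ : C(U, U))

/-- The transformation monoid of `U`: generated, under composition, by the unary operations. -/
def transMonoid : Submonoid (ContTrans U) :=
  Submonoid.closure (Set.range fun a : A => opTrans a U)

/-- The monoid `μ(U)`: the closure of the transformation monoid in the monoid of all continuous
transformations, for the compact-open topology. -/
def mu : Submonoid (ContTrans U) :=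
  haveI : CompactSpace U := IsProfiniteUnaryAlg.toCompactSpace A
  haveI : T2Space U := IsProfiniteUnaryAlg.toT2Space A
  (transMonoid A U).topologicalClosure

theorem coe_mu : (mu A U : Set (ContTrans U)) = closure (transMonoid A U : Set (ContTrans U)) :=
  rfl

theorem opTrans_mem_mu (a : A) : opTrans a U ∈ mu A U :=
  subset_closure (Submonoid.subset_closure ⟨a, rfl⟩)

variable {A U}

/-- Elements of `μ(U)` respect the kernels of continuous homomorphisms. -/
theorem mu_respects {V : Type*} [UnaryAlg A V] [TopologicalSpace V] [T2Space V] {h : U → V}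
    (hc : Continuous h) (hh : UnaryAlg.IsHom A h) {f : ContTrans U} (hf : f ∈ mu A U)
    {x y : U} (hxy : h x = h y) : h (f x) = h (f y) := by
  have hcl : IsClosed {f : ContTrans U | ∀ x y : U, h x = h y → h (f x) = h (f y)} := by
    simp only [Set.ofPred_forall]
    exact isClosed_iInter fun x => isClosed_iInter fun y => isClosed_iInter fun _ =>
      isClosed_eq (hc.comp (ContTrans.continuous_apply x)) (hc.comp (ContTrans.continuous_apply y))
  refine closure_minimal ?_ hcl hf x y hxy
  intro g hg
  induction hg using Submonoid.closure_induction with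
  | mem g hg =>
    obtain ⟨a, rfl⟩ := hg
    intro x y hxy
    exact (hh.map_op a x).trans ((congrArg _ hxy).trans (hh.map_op a y).symm)
  | one => exact fun x y hxy => hxy
  | mul g k _ _ ihg ihk => exact fun x y hxy => ihg _ _ (ihk _ _ hxy)

variable (A U)

theorem mu_compact : CompactSpace (mu A U) := by
  have : CompactSpace U := IsProfiniteUnaryAlg.toCompactSpace A
  have : T2Space U := IsProfiniteUnaryAlg.toT2Space A
  have hres := IsProfiniteUnaryAlg.residually_finite (A := A) (U := U)
  choose F iF hfin iT iD h hc hh hne using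
    fun p : {p : U × U // p.1 ≠ p.2} => hres p.1.1 p.1.2 p.2
  let e : U → ∀ p, F p := fun x p => h p x
  have he : Topology.IsClosedEmbedding e := by
    refine Continuous.isClosedEmbedding (continuous_pi hc) ?_
    intro x y hxy
    by_contra hn
    exact hne ⟨(x, y), hn⟩ (congrFun hxy ⟨(x, y), hn⟩)
  let E : Set (U → U) := {f | ∀ p x y, h p x = h p y → h p (f x) = h p (f y)}
  have hE : IsClosed E := by
    simp only [E, Set.ofPred_forall]
    exact isClosed_iInter fun p => isClosed_iInter fun x => isClosed_iInter fun y =>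
      isClosed_iInter fun _ =>
        isClosed_eq ((hc p).comp (_root_.continuous_apply x))
          ((hc p).comp (_root_.continuous_apply y))
  have : CompactSpace E := isCompact_iff_compactSpace.mp hE.isCompact
  have hev : Continuous fun q : E × U => q.1.1 q.2 := by
    rw [he.isInducing.continuous_iff]
    refine continuous_pi fun p => ?_
    rw [continuous_iff_continuousAt]
    rintro ⟨g, x⟩
    have h1 : ContinuousAt (fun q : E × U => h p (q.1.1 x)) (g, x) :=
      ((hc p).comp ((_root_.continuous_apply x).comp
        (continuous_subtype_val.comp continuous_fst))).continuousAt
    refine h1.congr ?_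
    have h2 : ∀ᶠ q : E × U in nhds (g, x), h p q.2 = h p x :=
      ((hc p).comp continuous_snd).continuousAt.eventually
        (p := fun z => z = h p x) (by simp [nhds_discrete])
    filter_upwards [h2] with q hq
    exact q.1.2 p _ _ hq.symm
  let c : C(E, C(U, U)) := ContinuousMap.curry ⟨fun q : E × U => q.1.1 q.2, hev⟩
  have hK : IsCompact (Set.range c) := isCompact_range c.continuous
  refine isCompact_iff_compactSpace.mp (hK.of_isClosed_subset isClosed_closure ?_)
  intro f hf
  exact ⟨⟨f, fun p x y hxy => mu_respects (hc p) (hh p) hf hxy⟩, rfl⟩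

instance mu_profinite : IsProfiniteMonoid (mu A U) := by
  have : CompactSpace U := IsProfiniteUnaryAlg.toCompactSpace A
  have : T2Space U := IsProfiniteUnaryAlg.toT2Space A
  have := mu_compact A U
  refine { residually_finite := ?_ }
  intro f g hfg
  obtain ⟨u, hu⟩ : ∃ u, f.1 u ≠ g.1 u := by
    by_contra! hn
    exact hfg (Subtype.ext (ContTrans.ext hn))
  obtain ⟨F, iF, hfin, iT, iD, h, hc, hh, hne⟩ :=
    IsProfiniteUnaryAlg.residually_finite (A := A) _ _ hu
  let lift : mu A U → Function.End (Set.range h) := fun f x => ⟨h (f.1 x.2.choose), ⟨_, rfl⟩⟩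
  have hlift : ∀ (f : mu A U) (x : U),
      lift f ⟨h x, ⟨x, rfl⟩⟩ = ⟨h (f.1 x), ⟨_, rfl⟩⟩ := fun f x =>
    Subtype.ext (mu_respects hc hh f.2 (Exists.choose_spec (⟨x, rfl⟩ : h x ∈ Set.range h)))
  let : TopologicalSpace (Function.End (Set.range h)) := ⊥
  have : DiscreteTopology (Function.End (Set.range h)) := ⟨rfl⟩
  have hfinite : Finite (Function.End (Set.range h)) :=
    inferInstanceAs (Finite (Set.range h → Set.range h))
  have hcont : Continuous lift := by
    have h1 : @Continuous (mu A U) (Set.range h → Set.range h) _ Pi.topologicalSpace lift :=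
      continuous_pi fun x => Continuous.subtype_mk
        (hc.comp ((ContTrans.continuous_apply x.2.choose).comp continuous_subtype_val)) _
    rw [continuous_discrete_rng]
    intro b
    exact (isOpen_discrete ({b} : Set (Set.range h → Set.range h))).preimage h1
  refine ⟨Function.End (Set.range h), inferInstance, hfinite, _, ‹_›,
    { toFun := lift, map_one' := ?_, map_mul' := ?_, continuous_toFun := hcont }, ?_⟩
  · funext x
    obtain ⟨_, ⟨x, rfl⟩⟩ := x
    exact hlift 1 x
  · intro f g
    funext x
    obtain ⟨_, ⟨x, rfl⟩⟩ := x
    exact (hlift (f * g) x).trans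
      ((hlift f (g.1 x)).symm.trans (congrArg (lift f) (hlift g x).symm))
  · intro heq
    have h2 : lift f ⟨h u, ⟨u, rfl⟩⟩ = lift g ⟨h u, ⟨u, rfl⟩⟩ := congrFun heq _
    rw [hlift, hlift] at h2
    exact hne (Subtype.ext_iff.mp h2)

/-- The canonical map `A → μ(U)`. -/
def muGen (a : A) : mu A U := ⟨opTrans a U, opTrans_mem_mu A U a⟩

theorem mu_generates :
    (Submonoid.closure (Set.range (muGen A U))).topologicalClosure = ⊤ := by
  have h1 : (Submonoid.closure (Set.range (muGen A U))).map (mu A U).subtype =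
      transMonoid A U := by
    rw [MonoidHom.map_mclosure, ← Set.range_comp]
    rfl
  rw [eq_top_iff]
  rintro ⟨f, hf⟩ -
  change _ ∈ closure _
  rw [closure_subtype]
  have h2 : ((mu A U).subtype '' (Submonoid.closure (Set.range (muGen A U)) : Set (mu A U)))
      = (transMonoid A U : Set (ContTrans U)) := congrArg SetLike.coe h1
  change f ∈ closure ((mu A U).subtype '' _)
  rw [h2]
  exact hf

end Mu

/-! ### The functor `Γ` -/

section Check

variable {A : Type v} {U V W : PUA.{u} A}

/-- For a morphism `φ : U → V` and `f ∈ μ(U)` there is `g ∈ μ(V)` with `g ∘ φ = φ ∘ f`. -/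
theorem check_exists (φ : PUA.Hom U V) (f : mu A U.carrier) :
    ∃ g : mu A V.carrier, ∀ x, g.1 (φ.map x) = φ.map (f.1 x) := by
  have hK : IsCompact {q : ContTrans U.carrier × ContTrans V.carrier |
      q.1 ∈ mu A U.carrier ∧ q.2 ∈ mu A V.carrier ∧ ∀ x, q.2 (φ.map x) = φ.map (q.1 x)} := by
    have h1 : IsCompact ((mu A U.carrier : Set (ContTrans U.carrier)) ×ˢ
        (mu A V.carrier : Set (ContTrans V.carrier))) :=
      (isCompact_iff_compactSpace.mpr (mu_compact A _)).prod
        (isCompact_iff_compactSpace.mpr (mu_compact A _))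
    have h2 : IsClosed {q : ContTrans U.carrier × ContTrans V.carrier |
        ∀ x, q.2 (φ.map x) = φ.map (q.1 x)} := by
      simp only [Set.ofPred_forall]
      exact isClosed_iInter fun x => isClosed_eq
        ((ContTrans.continuous_apply _).comp continuous_snd)
        (φ.map.continuous.comp ((ContTrans.continuous_apply _).comp continuous_fst))
    convert h1.inter_right h2 using 1
    ext q
    simp [and_assoc]
  have hcl := (hK.image continuous_fst).isClosed
  have hsub : (transMonoid A U.carrier : Set (ContTrans U.carrier)) ⊆
      Prod.fst '' {q : ContTrans U.carrier × ContTrans V.carrier |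
        q.1 ∈ mu A U.carrier ∧ q.2 ∈ mu A V.carrier ∧ ∀ x, q.2 (φ.map x) = φ.map (q.1 x)} := by
    intro k hk
    induction hk using Submonoid.closure_induction with
    | mem k hk =>
      obtain ⟨a, rfl⟩ := hk
      exact ⟨(opTrans a _, opTrans a _), ⟨opTrans_mem_mu A _ a, opTrans_mem_mu A _ a,
        fun x => (φ.isHom.map_op a x).symm⟩, rfl⟩
    | one => exact ⟨(1, 1), ⟨one_mem _, one_mem _, fun _ => rfl⟩, rfl⟩
    | mul k l _ _ ihk ihl =>
      obtain ⟨⟨k, k'⟩, ⟨hk, hk', hkk⟩, rfl⟩ := ihk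
      obtain ⟨⟨l, l'⟩, ⟨hl, hl', hll⟩, rfl⟩ := ihl
      refine ⟨(k * l, k' * l'), ⟨mul_mem hk hl, mul_mem hk' hl', fun x => ?_⟩, rfl⟩
      exact (congrArg k' (hll x)).trans (hkk _)
  obtain ⟨⟨f', g⟩, ⟨_, hg, hfg⟩, hff⟩ := closure_minimal hsub hcl f.2
  refine ⟨⟨g, hg⟩, fun x => ?_⟩
  rw [← show f' = f.1 from hff]
  exact hfg x

/-- The map `μ(U) → μ(V)` induced by a morphism `φ : U → V`; it sends `f` to the unique `g`
with `g ∘ φ = φ ∘ f`. -/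
noncomputable def checkFun (φ : PUA.Hom U V) (f : mu A U.carrier) : mu A V.carrier :=
  (check_exists φ f).choose

theorem checkFun_apply (φ : PUA.Hom U V) (f : mu A U.carrier) (x : U.carrier) :
    (checkFun φ f).1 (φ.map x) = φ.map (f.1 x) :=
  (check_exists φ f).choose_spec x

theorem checkFun_unique (φ : PUA.Hom U V) (f : mu A U.carrier) (g : mu A V.carrier)
    (h : ∀ x, g.1 (φ.map x) = φ.map (f.1 x)) : checkFun φ f = g := by
  refine Subtype.ext (ContTrans.ext fun y => ?_)
  obtain ⟨x, rfl⟩ := φ.surjective y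
  rw [checkFun_apply, h]

theorem continuous_checkFun (φ : PUA.Hom U V) : Continuous (checkFun φ) := by
  refine Continuous.subtype_mk (f := fun f => (checkFun φ f).1) ?_ (fun f => (checkFun φ f).2)
  refine ContinuousMap.continuous_compactOpen.mpr fun K hK O hO => ?_
  have h1 : IsOpen {f : ContTrans U.carrier |
      Set.MapsTo f (φ.map ⁻¹' K) (φ.map ⁻¹' O)} :=
    ContinuousMap.isOpen_setOfPred_mapsTo (hK.isClosed.preimage φ.map.continuous).isCompact
      (hO.preimage φ.map.continuous)
  convert h1.preimage (continuous_subtype_val (p := (· ∈ mu A U.carrier))) using 1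
  ext f
  constructor
  · intro h x hx
    change φ.map (f.1 x) ∈ O
    rw [← checkFun_apply]
    exact h hx
  · intro h y hy
    obtain ⟨x, rfl⟩ := φ.surjective y
    have := h hy
    change φ.map (f.1 x) ∈ O at this
    rw [← checkFun_apply] at this
    exact this

/-- The induced map `μ(U) → μ(V)` as a continuous monoid homomorphism. -/
noncomputable def checkHom (φ : PUA.Hom U V) : mu A U.carrier →ₜ* mu A V.carrier where
  toFun := checkFun φ
  map_one' := checkFun_unique φ _ _ fun _ => rfl
  map_mul' f g := checkFun_unique φ _ _ fun x =>
    (congrArg (checkFun φ f).1 (checkFun_apply φ g x)).trans (checkFun_apply φ f _)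
  continuous_toFun := continuous_checkFun φ

end Check

/-- The functor `Γ`, sending an algebra `U` to the closure `μ(U)` of its transformation monoid,
together with the canonical map `A → μ(U)`. -/
noncomputable def Gamma (A : Type v) : PUA.{u} A ⥤ PM.{u} A where
  obj U :=
    { carrier := mu A U.carrier
      gen := muGen A U.carrier
      generates := mu_generates A U.carrier }
  map φ := ⟨checkHom φ, fun a => checkFun_unique φ _ _ fun x => (φ.isHom.map_op a x).symm⟩
  map_id _ := PM.Hom.ext (ContinuousMonoidHom.ext fun _ =>
    checkFun_unique _ _ _ fun _ => rfl)
  map_comp φ ψ := PM.Hom.ext (ContinuousMonoidHom.ext fun f =>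
    checkFun_unique _ _ _ fun x =>
      (checkFun_apply ψ _ _).trans (congrArg ψ.map (checkFun_apply φ f x)))

/-! Both categories are thin: two parallel morphisms agree on a closed substructure containing the
generators (respectively the constant), and by hypothesis that is everything. In thin categories
naturality and the triangle identities are automatic, so an adjunction amounts to having some
morphism `X ⟶ Γ(Ψ X)` for each `X` and some morphism `Ψ(Γ U) ⟶ U` for each `U`. The first is the
Cayley representation, an element acting by left multiplication; the point to check is that these
translations lie in the closure `mu` (`leftMul_mem_mu`). The second evaluates a transformation at
the constant. -/

/-! ### Thinness of the two categories -/

/-- A morphism of `A`-generated profinite monoids is determined by the generators. -/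
instance PM.Hom.subsingleton {A : Type v} (X Y : PM.{u} A) : Subsingleton (X ⟶ Y) where
  allEq f g := by
    have h1 : (Submonoid.closure (Set.range X.gen) : Set X.carrier) ⊆
        {x | f.map x = g.map x} := by
      refine Submonoid.closure_le (S := MonoidHom.eqLocusM f.map.toMonoidHom g.map.toMonoidHom)
        |>.mpr ?_
      rintro _ ⟨a, rfl⟩
      exact (f.map_gen a).trans (g.map_gen a).symm
    -- The target is Hausdorff, so the equalizer is closed and contains the closure of the generated
    -- submonoid.
    have h2 := closure_minimal h1
      (isClosed_eq f.map.continuous_toFun g.map.continuous_toFun)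
    rw [← Submonoid.coe_topologicalClosure, X.generates] at h2
    exact PM.Hom.ext (ContinuousMonoidHom.ext fun x => h2 (Submonoid.mem_top x))

/-- There is at most one morphism between algebras without proper closed subalgebras. -/
instance PUA.Hom.subsingleton {A : Type v} (U V : PUA.{u} A) : Subsingleton (U ⟶ V) where
  allEq f g := by
    -- The equalizer of two homomorphisms is a subalgebra, closed because `V` is Hausdorff.
    have h := U.no_proper {x | f.map x = g.map x}
      (isClosed_eq f.map.continuous g.map.continuous)
      (f.isHom.map_pt.trans g.isHom.map_pt.symm)
      (fun a x hx => (f.isHom.map_op a x).trans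
        ((congrArg _ hx).trans (g.isHom.map_op a x).symm))
    exact PUA.Hom.ext (ContinuousMap.ext fun x => Set.eq_univ_iff_forall.mp h x)

/-! ### Unit, counit and the adjunction -/

/-- Left multiplication, as a homomorphism to the monoid of continuous transformations. -/
def leftMul (M : Type u) [Monoid M] [TopologicalSpace M] [ContinuousMul M] :
    M →ₜ* ContTrans M where
  toFun m := (⟨fun x => m * x, continuous_const.mul continuous_id⟩ : C(M, M))
  map_one' := ContTrans.ext one_mul
  map_mul' m n := ContTrans.ext (mul_assoc m n)
  -- Currying a jointly continuous map gives a continuous map into the compact-open topology.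
  continuous_toFun := (ContinuousMap.curry ⟨fun q : M × M => q.1 * q.2, continuous_mul⟩).continuous

/-- The elements whose left translation lies in `mu` form a closed submonoid, the preimage of a
closed submonoid under `leftMul`. It contains the generators, so it is all of `X`. -/
theorem leftMul_mem_mu {A : Type v} (X : PM.{u} A) (m : X.carrier) :
    leftMul X.carrier m ∈ mu A ((Psi A).obj X).carrier := by
  let S : Submonoid (ContTrans X.carrier) := mu A ((Psi A).obj X).carrier
  have hS : IsClosed (S : Set (ContTrans X.carrier)) := isClosed_closure
  have h1 : Submonoid.closure (Set.range X.gen) ≤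
      S.comap (leftMul X.carrier).toMonoidHom := by
    refine Submonoid.closure_le.mpr ?_
    rintro _ ⟨a, rfl⟩
    -- By the definition of `Psi`, translation by `X.gen a` is the operation `a`.
    exact opTrans_mem_mu A ((Psi A).obj X).carrier a
  have h2 := Submonoid.topologicalClosure_minimal _ h1
    (hS.preimage (leftMul X.carrier).continuous_toFun)
  rw [X.generates] at h2
  exact h2 (Submonoid.mem_top m)

/-- The unit of the adjunction: an element of `M` is sent to left multiplication by it. -/
noncomputable def unitHom {A : Type v} (X : PM.{u} A) : X ⟶ (Gamma A).obj ((Psi A).obj X) where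
  map :=
    { toFun := fun m => ⟨leftMul X.carrier m, leftMul_mem_mu X m⟩
      map_one' := Subtype.ext (leftMul X.carrier).map_one
      map_mul' := fun m n => Subtype.ext ((leftMul X.carrier).map_mul m n)
      continuous_toFun := (leftMul X.carrier).continuous_toFun.subtype_mk _ }
  map_gen _ := rfl

/-- The counit of the adjunction: evaluation at the constant. -/
noncomputable def counitHom {A : Type v} (U : PUA.{u} A) : (Psi A).obj ((Gamma A).obj U) ⟶ U where
  map := ⟨fun f : mu A U.carrier => f.1 (UnaryAlg.pt A),
    (ContTrans.continuous_apply _).comp continuous_subtype_val⟩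
  -- Multiplication in `mu` is composition, so the symbol `a` acts by postcomposing with the
  -- operation `a` of `U`, which commutes with evaluation at a point; the identity fixes the
  -- constant.
  isHom := ⟨fun _ _ => rfl, rfl⟩

theorem theorem6p5 (A : Type v) [Finite A] : Nonempty (Psi.{u} A ⊣ Gamma.{u} A) :=
  ⟨.mkOfUnitCounit
    { unit := { app := unitHom, naturality := fun _ _ _ => Subsingleton.elim _ _ }
      counit := { app := counitHom, naturality := fun _ _ _ => Subsingleton.elim _ _ }
      left_triangle := by
        ext X
        -- The explicit `α` unfolds the composites with identity functors, exhibiting both sides as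
        -- endomorphisms of one object.
        exact Subsingleton.elim (α := (Psi A).obj X ⟶ (Psi A).obj X) _ _
      right_triangle := by
        ext U
        exact Subsingleton.elim (α := (Gamma A).obj U ⟶ (Gamma A).obj U) _ _ }⟩
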